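/- Consider structures over a first-order signature with arbitrarily many relation symbols but only countably many function and constant symbols; embeddings are injective homomorphisms that preserve and reflect all relations. Let $\mathcal{C}$ be a Fraïssé class (a nonempty class of finitely generated structures with countably many isomorphism types and with the hereditary, joint embedding and amalgamation properties), and let $\mathbf{U}$ be its Fraïssé limit, i.e. the countable homogeneous structure whose age (the class of all finitely generated structures that embed into it) is $\mathcal{C}$. Write $\overline{\mathcal{C}}$ for the class of all countable structures whose age is contained in $\mathcal{C}$. Then the following are equivalent. (1) $\mathcal{C}$ has both of the following properties. - Homo amalgamation property (HAP): for all $\mathbf{A},\mathbf{B}_1,\mathbf{B}_2\in\mathcal{C}$, every embedding $f_1:\mathbf{A}\hookrightarrow\mathbf{B}_1$ and every homomorphism $f_2:\mathbf{A}\to\mathbf{B}_2$, there are $\mathbf{C}\in\mathcal{C}$, a homomorphism $g_1:\mathbf{B}_1\to\mathbf{C}$ and an embedding $g_2:\mathbf{B}_2\hookrightarrow\mathbf{C}$ with $g_1\circ f_1=g_2\circ f_2$. - Amalgamated extension property: for all $\mathbf{A},\mathbf{B}_1,\mathbf{B}_2,\mathbf{T}\in\mathcal{C}$, all embeddings $f_1:\mathbf{A}\hookrightarrow\mathbf{B}_1$,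 $f_2:\mathbf{A}\hookrightarrow\mathbf{B}_2$ and all homomorphisms $h_1:\mathbf{B}_1\to\mathbf{T}$, $h_2:\mathbf{B}_2\to\mathbf{T}$ with $h_1\circ f_1=h_2\circ f_2$, there are $\mathbf{C},\mathbf{T}'\in\mathcal{C}$, embeddings $g_1:\mathbf{B}_1\hookrightarrow\mathbf{C}$, $g_2:\mathbf{B}_2\hookrightarrow\mathbf{C}$, $k:\mathbf{T}\hookrightarrow\mathbf{T}'$ and a homomorphism $h:\mathbf{C}\to\mathbf{T}'$ with $g_1\circ f_1=g_2\circ f_2$, $h\circ g_1=k\circ h_1$ and $h\circ g_2=k\circ h_2$. (2) Every retract $\mathbf{B}$ of $\mathbf{U}$ (that is, every substructure that is the image of an idempotent endomorphism of $\mathbf{U}$) is induced by a universal homogeneous retraction, that is, there is a homomorphism $r:\mathbf{U}\to\mathbf{B}$ such that - $r$ is a retraction: $r\circ\iota=1_{\mathbf{B}}$ for some homomorphism $\iota:\mathbf{B}\to\mathbf{U}$ (not necessarily the inclusion); - $r$ is universal within $\overline{\mathcal{C}}$: for every $\mathbf{A}\in\overline{\mathcal{C}}$ and every homomorphism $h:\mathbf{A}\to\mathbf{B}$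 there is an embedding $\iota:\mathbf{A}\hookrightarrow\mathbf{U}$ with $h=r\circ\iota$; - $r$ is homogeneous: for every finitely generated substructure $\mathbf{A}$ of $\mathbf{U}$ and every embedding $\iota:\mathbf{A}\hookrightarrow\mathbf{U}$ with $r\circ\iota=r|_{A}$ there is an automorphism $\alpha$ of $\mathbf{U}$ with $r\circ\alpha=r$ and $\alpha|_{A}=\iota$. -/

import Mathlib

open CategoryTheory
open scoped FirstOrder

universe u v w

namespace FirstOrder.Language

/-- `younger K` (usually written as `K` with a bar): all countable structures whose age is
contained in `K`. -/
def younger {L : Language.{u, v}} (K : Set (Bundled.{w} L.Structure)) :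
    Set (Bundled.{w} L.Structure) :=
  {M | Countable M ∧ L.age M ⊆ K}

/-- The homo amalgamation property (HAP): every span of an embedding `f₁ : A ↪ B₁` and a
homomorphism `f₂ : A → B₂` in `K` is completed by a homomorphism `g₁ : B₁ → C` and an
embedding `g₂ : B₂ ↪ C` with `C` in `K`. -/
def HomoAmalgamation {L : Language.{u, v}} (K : Set (Bundled.{w} L.Structure)) : Prop :=
  ∀ (A B₁ B₂ : Bundled.{w} L.Structure), A ∈ K → B₁ ∈ K → B₂ ∈ K →
    ∀ (f₁ : A ↪[L] B₁) (f₂ : A →[L] B₂),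
      ∃ C : Bundled.{w} L.Structure, C ∈ K ∧
        ∃ (g₁ : B₁ →[L] C) (g₂ : B₂ ↪[L] C), g₁.comp f₁.toHom = g₂.toHom.comp f₂

/-- The amalgamated extension property. -/
def AmalgamatedExtension {L : Language.{u, v}} (K : Set (Bundled.{w} L.Structure)) : Prop :=
  ∀ (A B₁ B₂ T : Bundled.{w} L.Structure), A ∈ K → B₁ ∈ K → B₂ ∈ K → T ∈ K →
    ∀ (f₁ : A ↪[L] B₁) (f₂ : A ↪[L] B₂) (h₁ : B₁ →[L] T) (h₂ : B₂ →[L] T),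
      h₁.comp f₁.toHom = h₂.comp f₂.toHom →
      ∃ C T' : Bundled.{w} L.Structure, C ∈ K ∧ T' ∈ K ∧
        ∃ (g₁ : B₁ ↪[L] C) (g₂ : B₂ ↪[L] C) (h : C →[L] T') (k : T ↪[L] T'),
          g₁.comp f₁ = g₂.comp f₂ ∧
          h.comp g₁.toHom = k.toHom.comp h₁ ∧
          h.comp g₂.toHom = k.toHom.comp h₂

/-- A homomorphism `u : U → T` is universal within `younger K` if every homomorphism `h : A → T`
with `A` in `younger K` factors as `u ∘ ι` for some embedding `ι : A ↪ U`. -/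
def IsUniversalHom {L : Language.{u, v}} (K : Set (Bundled.{w} L.Structure))
    {U T : Type w} [L.Structure U] [L.Structure T] (u : U →[L] T) : Prop :=
  ∀ A : Bundled.{w} L.Structure, A ∈ younger K → ∀ h : A →[L] T,
    ∃ ι : A ↪[L] U, h = u.comp ι.toHom

/-- A homomorphism `u : U → T` is homogeneous if every embedding `ι` into `U` of a finitely
generated substructure `A` of `U` with `u ∘ ι = u` on `A` extends to an automorphism `α` of `U`
with `u ∘ α = u`. -/
def IsHomogeneousHom {L : Language.{u, v}}
    {U T : Type w} [L.Structure U] [L.Structure T] (u : U →[L] T) : Prop :=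
  ∀ A : L.Substructure U, A.FG → ∀ ι : A ↪[L] U, u.comp A.subtype.toHom = u.comp ι.toHom →
    ∃ α : U ≃[L] U, u.comp α.toHom = u ∧ α.toEmbedding.comp A.subtype = ι

/-- A homomorphism is a retraction if it has a right inverse that is a homomorphism. -/
def IsRetraction {L : Language.{u, v}}
    {A B : Type w} [L.Structure A] [L.Structure B] (r : A →[L] B) : Prop :=
  ∃ ι : B →[L] A, r.comp ι = Hom.id L B

/-- A retraction `r : A → B`, where `B` lies in `younger (L.age A)`, is a universal homogeneous
retraction if it is universal within `younger (L.age A)` and homogeneous. -/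
structure IsUniversalHomogeneousRetraction {L : Language.{u, v}}
    {A B : Type w} [L.Structure A] [L.Structure B] (r : A →[L] B) : Prop where
  mem_younger : (Bundled.of B : Bundled.{w} L.Structure) ∈ younger (L.age A)
  isRetraction : IsRetraction r
  isUniversalHom : IsUniversalHom (L.age A) r
  isHomogeneousHom : IsHomogeneousHom r

/-- A substructure `B` of `A` is a retract of `A` if it is the image of an idempotent
endomorphism of `A`. -/
def IsRetract {L : Language.{u, v}} {A : Type w} [L.Structure A] (B : L.Substructure A) : Prop :=
  ∃ e : A →[L] A, e.comp e = e ∧ e.range = B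

end FirstOrder.Language

/-! Let `B` be a retract of the limit `U`. A homomorphism from a member of the age to `B` has
finitely generated range, which is itself in the age. The HAP and the amalgamated extension property
can thus be applied over it, their results embedded into `U` by ultrahomogeneity and retracted to
`B`. So homomorphisms to `B` extend, and structures over `B` amalgamate. A generic homomorphism `r :
U → B` therefore exists (`exists_isRich`), and back-and-forth over `B` makes it universal and
homogeneous; lifting the identity of `B` gives its section. Conversely, the retract `U` itself
suffices: universality lifts homomorphisms to embeddings, and homogeneity aligns the lifts. -/

namespace FirstOrder.Language

open Structure Substructure

/-! ### Extension and amalgamation over a retract -/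

section Amalgamation

variable {L : Language.{u, v}} {U B : Type w} [L.Structure U] [L.Structure B]

/-- If the age of an ultrahomogeneous structure `U` has the HAP, then homomorphisms into a retract
`B` of `U` extend along embeddings between members of the age. -/
theorem HomoAmalgamation.exists_hom_extension (hap : HomoAmalgamation (L.age U))
    (hom : L.IsUltrahomogeneous U) (s : B ↪[L] U) (ρ : U →[L] B) (hρ : ∀ b, ρ (s b) = b)
    {A A' : Type w} [L.Structure A] [L.Structure A'] (hA : (Bundled.of A : Bundled.{w} L.Structure) ∈ L.age U)
    (hA' : (Bundled.of A' : Bundled.{w} L.Structure) ∈ L.age U) (f : A ↪[L] A') (h : A →[L] B) :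
    ∃ h' : A' →[L] B, ∀ a, h' (f a) = h a := by
  have hT : FG L h.range := (fg_iff_structure_fg _).1 (FG.range hA.1 h)
  -- `B` need not be finitely generated, so the range of `h` replaces it.
  obtain ⟨C, hC, g₁, g₂, hg⟩ := hap (Bundled.of A) (Bundled.of A') (Bundled.of h.range) hA hA'
    ⟨hT, ⟨s.comp h.range.subtype⟩⟩ f (h.codRestrict h.range h.mem_range_self)
  have := hC.2
  obtain ⟨f', hf'⟩ := hom.extend_embedding hT (s.comp h.range.subtype) g₂
  refine ⟨ρ.comp (f'.toHom.comp g₁), fun a => ?_⟩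
  have e₁ := DFunLike.congr_fun hg a
  have e₂ := DFunLike.congr_fun hf' (h.codRestrict h.range h.mem_range_self a)
  exact (congrArg ρ ((congrArg f' e₁).trans e₂.symm)).trans (hρ _)

/-- If the age of an ultrahomogeneous structure `U` has the amalgamated extension property, then
the members of the age over a retract `B` of `U` have the amalgamation property. -/
theorem AmalgamatedExtension.exists_amalgam_over (aep : AmalgamatedExtension (L.age U))
    (hom : L.IsUltrahomogeneous U) (s : B ↪[L] U) (ρ : U →[L] B) (hρ : ∀ b, ρ (s b) = b)
    {A B₁ B₂ : Type w} [L.Structure A] [L.Structure B₁] [L.Structure B₂]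
    (hA : (Bundled.of A : Bundled.{w} L.Structure) ∈ L.age U)
    (hB₁ : (Bundled.of B₁ : Bundled.{w} L.Structure) ∈ L.age U)
    (hB₂ : (Bundled.of B₂ : Bundled.{w} L.Structure) ∈ L.age U)
    (f₁ : A ↪[L] B₁) (f₂ : A ↪[L] B₂) (h₁ : B₁ →[L] B) (h₂ : B₂ →[L] B)
    (hf : ∀ a, h₁ (f₁ a) = h₂ (f₂ a)) :
    ∃ C : Bundled.{w} L.Structure, C ∈ L.age U ∧
      ∃ (g₁ : B₁ ↪[L] C) (g₂ : B₂ ↪[L] C) (h : C →[L] B),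
        (∀ a, g₁ (f₁ a) = g₂ (f₂ a)) ∧ (∀ b, h (g₁ b) = h₁ b) ∧ ∀ b, h (g₂ b) = h₂ b := by
  let T := h₁.range ⊔ h₂.range
  have hT : FG L T := (fg_iff_structure_fg _).1 ((FG.range hB₁.1 h₁).sup (FG.range hB₂.1 h₂))
  let k₁ : B₁ →[L] T := h₁.codRestrict T fun b => le_sup_left (a := h₁.range) (h₁.mem_range_self b)
  let k₂ : B₂ →[L] T := h₂.codRestrict T fun b => le_sup_right (a := h₁.range) (h₂.mem_range_self b)
  obtain ⟨C, T', hC, hT', g₁, g₂, h, k, e, e₁, e₂⟩ := aep (Bundled.of A) (Bundled.of B₁)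
    (Bundled.of B₂) (Bundled.of T) hA hB₁ hB₂ ⟨hT, ⟨s.comp T.subtype⟩⟩ f₁ f₂ k₁ k₂
    (Hom.ext fun a => Subtype.ext (hf a))
  have := hT'.2
  -- `T'` is placed in `U` so that `T` keeps its position; `ρ` then returns to `B` without moving
  -- `T`.
  obtain ⟨f', hf'⟩ := hom.extend_embedding hT (s.comp T.subtype) k
  refine ⟨C, hC, g₁, g₂, ρ.comp (f'.toHom.comp h), DFunLike.congr_fun e, fun b => ?_, fun b => ?_⟩
  · exact (congrArg ρ ((congrArg f' (DFunLike.congr_fun e₁ b)).trans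
      (DFunLike.congr_fun hf' (k₁ b)).symm)).trans (hρ _)
  · exact (congrArg ρ ((congrArg f' (DFunLike.congr_fun e₂ b)).trans
      (DFunLike.congr_fun hf' (k₂ b)).symm)).trans (hρ _)

end Amalgamation

/-! ### The poset of finitely generated partial homomorphisms -/

section PartialHom

variable (L : Language.{u, v}) (M N : Type w) [L.Structure M] [L.Structure N]

/-- A homomorphism to `N` from a finitely generated substructure of `M`. -/
structure PartialHom where
  /-- The domain of the partial homomorphism. -/
  dom : L.Substructure M
  /-- The underlying homomorphism. -/
  toHom : dom →[L] N
  fg : dom.FG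

variable {L M N}

namespace PartialHom

instance : Preorder (PartialHom L M N) where
  le p q := ∃ h : p.dom ≤ q.dom, ∀ x : p.dom, q.toHom (Substructure.inclusion h x) = p.toHom x
  le_refl _ := ⟨le_rfl, fun _ => rfl⟩
  le_trans _ _ _ := fun ⟨h₁, e₁⟩ ⟨h₂, e₂⟩ =>
    ⟨h₁.trans h₂, fun x => (e₂ (Substructure.inclusion h₁ x)).trans (e₁ x)⟩

theorem dom_mono {p q : PartialHom L M N} (h : p ≤ q) : p.dom ≤ q.dom := h.1

theorem apply_eq_of_le {p q : PartialHom L M N} (h : p ≤ q) {x : M} (hx : x ∈ p.dom) :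
    q.toHom ⟨x, dom_mono h hx⟩ = p.toHom ⟨x, hx⟩ := h.2 ⟨x, hx⟩

theorem structure_fg (p : PartialHom L M N) : FG L p.dom := (fg_iff_structure_fg _).1 p.fg

instance [Countable M] [Countable N] : Countable (PartialHom L M N) := by
  have (S : {S : L.Substructure M // S.FG}) : Countable (S.1 →[L] N) :=
    ((fg_iff_structure_fg _).1 S.2).countable_hom N
  let g : PartialHom L M N → Σ S : {S : L.Substructure M // S.FG}, S.1 →[L] N :=
    fun p => ⟨⟨p.dom, p.fg⟩, p.toHom⟩
  refine Function.Injective.countable (f := g) ?_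
  rintro ⟨_, _, _⟩ ⟨_, _, _⟩ h
  cases h
  rfl

/-- A monotone sequence of partial homomorphisms whose domains cover `M` has a union. -/
theorem exists_hom_of_monotone {S : ℕ → PartialHom L M N} (hS : Monotone S)
    (cover : ∀ x, ∃ n, x ∈ (S n).dom) :
    ∃ r : M →[L] N, ∀ n (x : (S n).dom), r x = (S n).toHom x := by
  choose c hc using cover
  have key (n : ℕ) (x : M) (hx : x ∈ (S n).dom) :
      (S (c x)).toHom ⟨x, hc x⟩ = (S n).toHom ⟨x, hx⟩ :=
    (apply_eq_of_le (hS (le_max_left (c x) n)) (hc x)).symm.trans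
      (apply_eq_of_le (hS (le_max_right (c x) n)) hx)
  have bound {n : ℕ} (x : Fin n → M) : ∃ m, ∀ i, x i ∈ (S m).dom :=
    ⟨Finset.univ.sup (c ∘ x), fun i =>
      dom_mono (hS (Finset.le_sup (f := c ∘ x) (Finset.mem_univ i))) (hc (x i))⟩
  refine ⟨⟨fun x => (S (c x)).toHom ⟨x, hc x⟩, fun {n} f x => ?_, fun {n} R x h => ?_⟩,
    fun n x => key n x x.2⟩
  · obtain ⟨m, hm⟩ := bound x
    rw [key m _ ((S m).dom.fun_mem f x hm)]
    refine ((S m).toHom.map_fun f fun i => ⟨x i, hm i⟩).trans ?_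
    congr 1
    exact funext fun i => (key m _ (hm i)).symm
  · obtain ⟨m, hm⟩ := bound x
    have := (S m).toHom.map_rel R (fun i => ⟨x i, hm i⟩) h
    convert! this using 1
    exact funext fun i => key m _ (hm i)

end PartialHom

end PartialHom

/-! ### Construction of a generic homomorphism -/

section Generic

variable {L : Language.{u, v}} {U B : Type w} [L.Structure U] [L.Structure B]

/-- In an ultrahomogeneous structure `U`, extensions of the domain of a partial homomorphism within
the age of `U` are realised by larger partial homomorphisms. -/
theorem PartialHom.exists_le_of_extension (hom : L.IsUltrahomogeneous U) (p : PartialHom L U B)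
    {D : Type w} [L.Structure D] (hD : (Bundled.of D : Bundled.{w} L.Structure) ∈ L.age U)
    (g : p.dom ↪[L] D) (h : D →[L] B) (hg : ∀ a, h (g a) = p.toHom a) :
    ∃ q : PartialHom L U B, p ≤ q ∧ ∃ e : D ↪[L] q.dom,
      (∀ a, (e (g a) : U) = a) ∧ ∀ x, q.toHom (e x) = h x := by
  have : Nonempty (D ↪[L] U) := hD.2
  obtain ⟨j, hj⟩ := hom.extend_embedding p.structure_fg p.dom.subtype g
  have hj' (a) : j (g a) = a := (DFunLike.congr_fun hj a).symm
  have hq (x) : (h.comp j.equivRange.symm.toHom) (j.equivRange x) = h x :=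
    congrArg h (j.equivRange.symm_apply_apply x)
  refine ⟨⟨j.toHom.range, h.comp j.equivRange.symm.toHom, FG.range hD.1 j.toHom⟩,
    ⟨fun x hx => ⟨g ⟨x, hx⟩, hj' _⟩, fun x => ?_⟩, j.equivRange.toEmbedding, hj', hq⟩
  refine Eq.trans ?_ ((hq (g x)).trans (hg x))
  exact congrArg (h.comp j.equivRange.symm.toHom) (Subtype.ext (hj' x).symm)

/-- `IsRich r` is the extension property of a generic homomorphism `r : U → B`: over `B`, finitely
generated extensions within the age of `U` of finitely generated substructures are realised. -/
def IsRich (r : U →[L] B) : Prop :=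
  ∀ {A D : Type w} [L.Structure A] [L.Structure D],
    (Bundled.of A : Bundled.{w} L.Structure) ∈ L.age U →
    (Bundled.of D : Bundled.{w} L.Structure) ∈ L.age U →
    ∀ (i : A ↪[L] U) (f : A ↪[L] D) (h : D →[L] B), (∀ a, h (f a) = r (i a)) →
      ∃ j : D ↪[L] U, (∀ a, j (f a) = i a) ∧ ∀ x, r (j x) = h x

/-- A Rasiowa–Sikorski argument: `r` is the union of a chain meeting countably many cofinal sets.
The HAP makes totality cofinal, the amalgamated extension property makes each extension problem
cofinal. -/
theorem exists_isRich [Countable U] [Countable B] (hom : L.IsUltrahomogeneous U) (s : B ↪[L] U)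
    (ρ : U →[L] B) (hρ : ∀ b, ρ (s b) = b) (hap : HomoAmalgamation (L.age U))
    (aep : AmalgamatedExtension (L.age U)) : ∃ r : U →[L] B, IsRich r := by
  let P := PartialHom L U B
  have embCountable (p q : P) : Countable (p.dom ↪[L] q.dom) :=
    p.structure_fg.countable_embedding _
  let I := U ⊕ Σ p q : P, p.dom ↪[L] q.dom
  have : Encodable I := Encodable.ofCountable _
  let good (p q : P) (f : p.dom ↪[L] q.dom) (t : P) : Prop :=
    ∃ e : q.dom ↪[L] t.dom, (∀ a, (e (f a) : U) = a) ∧ ∀ x, t.toHom (e x) = q.toHom x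
  have cofinal_dom (x : U) : IsCofinal {t : P | x ∈ t.dom} := fun t => by
    let D := closure L {x} ⊔ t.dom
    have hD : D.FG := (fg_closure_singleton x).sup t.fg
    obtain ⟨h, hh⟩ := hap.exists_hom_extension hom s ρ hρ (age.fg_substructure t.fg)
      (age.fg_substructure hD) (Substructure.inclusion le_sup_right) t.toHom
    exact ⟨⟨D, h, hD⟩, le_sup_left (a := closure L {x}) (subset_closure rfl), le_sup_right, hh⟩
  -- The second alternative, incompatibility with `p`, keeps the set cofinal when no extension of
  -- `t` lies above `p`.
  have cofinal_good (p q : P) (f : p.dom ↪[L] q.dom) :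
      IsCofinal {t : P | (∀ a, q.toHom (f a) = p.toHom a) →
        good p q f t ∨ ∀ t', t ≤ t' → ¬ p ≤ t'} := fun t => by
    by_cases hf : ∀ a, q.toHom (f a) = p.toHom a
    swap
    · exact ⟨t, fun h => absurd h hf, le_rfl⟩
    by_cases ht : ∃ t', t ≤ t' ∧ p ≤ t'
    swap
    · push Not at ht
      exact ⟨t, fun _ => Or.inr ht, le_rfl⟩
    obtain ⟨t', tt', pt'⟩ := ht
    obtain ⟨C, hC, g₁, g₂, h, e, e₁, e₂⟩ := aep.exists_amalgam_over hom s ρ hρ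
      (age.fg_substructure p.fg) (age.fg_substructure q.fg) (age.fg_substructure t'.fg)
      f (Substructure.inclusion (PartialHom.dom_mono pt')) q.toHom t'.toHom
      (fun a => (hf a).trans (pt'.2 a).symm)
    obtain ⟨t'', ht'', j, hj, hj'⟩ := t'.exists_le_of_extension hom hC g₂ h e₂
    refine ⟨t'', fun _ => Or.inl ⟨j.comp g₁, fun a => ?_, fun x => (hj' _).trans (e₁ x)⟩,
      tt'.trans ht''⟩
    exact (congrArg (fun c => (j c : U)) (e a)).trans (hj _)
  let p₀ : P := ⟨⊥, ρ.comp (⊥ : L.Substructure U).subtype.toHom, fg_bot⟩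
  let 𝒟 : I → Order.Cofinal P := Sum.elim (fun x => ⟨_, cofinal_dom x⟩)
    fun c => ⟨_, cofinal_good c.1 c.2.1 c.2.2⟩
  let S := Order.sequenceOfCofinals p₀ 𝒟
  have hS : Monotone S := Order.sequenceOfCofinals.monotone p₀ 𝒟
  have cover (x : U) : ∃ n, x ∈ (S n).dom :=
    ⟨_, Order.sequenceOfCofinals.encode_mem p₀ 𝒟 (Sum.inl x)⟩
  obtain ⟨r, hr⟩ := PartialHom.exists_hom_of_monotone hS cover
  have cover_fg (A : L.Substructure U) (hA : A.FG) : ∃ n, A ≤ (S n).dom := by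
    obtain ⟨X, rfl⟩ := hA
    choose c hc using cover
    exact ⟨X.sup c, closure_le.2 fun x hx =>
      PartialHom.dom_mono (hS (Finset.le_sup (f := c) hx)) (hc x)⟩
  refine ⟨r, fun {A D} _ _ hA hD i f h hh => ?_⟩
  -- The arbitrary extension problem is copied into `U`, where it becomes one of the countably many
  -- already met.
  let p : P := ⟨i.toHom.range, r.comp i.toHom.range.subtype.toHom, FG.range hA.1 i.toHom⟩
  obtain ⟨q, -, eD, heD, heD'⟩ := p.exists_le_of_extension hom hD
    (f.comp i.equivRange.symm.toEmbedding) h fun a =>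
      (hh _).trans (congrArg (fun c => r c.1) (i.equivRange.apply_symm_apply a))
  let F : p.dom ↪[L] q.dom := eD.comp (f.comp i.equivRange.symm.toEmbedding)
  have hF (a) : q.toHom (F a) = p.toHom a := (heD' _).trans
    ((hh _).trans (congrArg (fun c => r c.1) (i.equivRange.apply_symm_apply a)))
  obtain ⟨m, hm⟩ := cover_fg p.dom p.fg
  have pm : p ≤ S m := ⟨hm, fun x => (hr m _).symm⟩
  obtain ⟨j, hj, hj'⟩ | h_not := Order.sequenceOfCofinals.encode_mem p₀ 𝒟 (Sum.inr ⟨p, q, F⟩) hF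
  · refine ⟨(Substructure.subtype _).comp (j.comp eD), fun a => ?_, fun x => ?_⟩
    · have := hj (i.equivRange a)
      have e : F (i.equivRange a) = eD (f a) :=
        congrArg (fun c => eD (f c)) (i.equivRange.symm_apply_apply a)
      rw [e] at this
      exact this
    · exact (hr _ _).trans ((hj' _).trans (heD' x))
  -- A later term of the chain lies above both `p` and the term claimed to be incompatible with it.
  · exact absurd (pm.trans (hS (le_max_right _ m))) (h_not _ (hS (le_max_left _ m)))

end Generic

/-! ### Back-and-forth over `B` -/

section BackAndForth

variable {L : Language.{u, v}} {M N B : Type w} [L.Structure M] [L.Structure N] [L.Structure B]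

/-- The equivalences between finitely generated substructures of `M` and `N` that commute with
given homomorphisms to `B`. -/
abbrev FGEquivOver (h : M →[L] B) (r : N →[L] B) :=
  {f : L.FGEquiv M N // ∀ x : f.1.dom, r (f.1.toEquiv x) = h x}

/-- The inverse of an equivalence over `B`. -/
def FGEquivOver.symm {h : M →[L] B} {r : N →[L] B} (f : FGEquivOver h r) : FGEquivOver r h :=
  ⟨f.1.symm, fun x =>
    (f.2 (f.1.1.toEquiv.symm x)).symm.trans
      (congrArg (fun c => r c.1) (f.1.1.toEquiv.apply_symm_apply x))⟩

/-- Every element of `M` can be added to the domain of any equivalence over `B`. -/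
def IsExtensionPairOver (h : M →[L] B) (r : N →[L] B) : Prop :=
  ∀ (f : FGEquivOver h r) (m : M), ∃ g : FGEquivOver h r, m ∈ g.1.1.dom ∧ f ≤ g

/-- The union of an increasing sequence of equivalences over `B` commutes with the homomorphisms
to `B`. -/
theorem FGEquivOver.partialEquivLimit_comm {h : M →[L] B} {r : N →[L] B}
    (S : ℕ →o FGEquivOver h r) :
    let S' : ℕ →o M ≃ₚ[L] N := ⟨fun n => (S n).1.1, fun _ _ hmn => S.monotone hmn⟩
    ∀ x, r ((DirectLimit.partialEquivLimit S').toEquiv x) = h x := by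
  intro S' x
  obtain ⟨n, hn⟩ := (mem_iSup_of_directed
    (Monotone.directed_le fun _ _ hmn => PartialEquiv.dom_le_dom (S'.monotone hmn))).1 x.2
  have e := PartialEquiv.toEquiv_inclusion_apply (DirectLimit.le_partialEquivLimit S' n) ⟨x, hn⟩
  exact (congrArg (fun c => r c.1) e).trans ((S n).2 ⟨x, hn⟩)

theorem IsExtensionPairOver.exists_embedding [Countable M] {h : M →[L] B} {r : N →[L] B}
    (H : IsExtensionPairOver h r) (g : FGEquivOver h r) : ∃ f : M ↪[L] N, ∀ x, r (f x) = h x := by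
  have : Encodable M := Encodable.ofCountable _
  let D : M → Order.Cofinal (FGEquivOver h r) := fun m => ⟨{f | m ∈ f.1.1.dom}, fun f => H f m⟩
  let S : ℕ →o FGEquivOver h r :=
    ⟨Order.sequenceOfCofinals g D, Order.sequenceOfCofinals.monotone _ _⟩
  let S' : ℕ →o M ≃ₚ[L] N := ⟨fun n => (S n).1.1, fun _ _ hmn => S.monotone hmn⟩
  have isTop : (DirectLimit.partialEquivLimit S').dom = ⊤ := top_le_iff.1 fun m _ =>
    PartialEquiv.dom_le_dom (DirectLimit.le_partialEquivLimit S' _)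
      (Order.sequenceOfCofinals.encode_mem g D m)
  refine ⟨PartialEquiv.toEmbeddingOfEqTop isTop, fun x => ?_⟩
  rw [PartialEquiv.toEmbeddingOfEqTop_apply]
  exact FGEquivOver.partialEquivLimit_comm S _

theorem IsExtensionPairOver.exists_equiv [Countable M] [Countable N] {h : M →[L] B} {r : N →[L] B}
    (H : IsExtensionPairOver h r) (H' : IsExtensionPairOver r h) (g : FGEquivOver h r) :
    ∃ f : M ≃[L] N, (∀ x, r (f x) = h x) ∧ ∀ x : g.1.1.dom, f x = g.1.1.toEquiv x := by
  have : Encodable M := Encodable.ofCountable _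
  have : Encodable N := Encodable.ofCountable _
  have cofinal_cod (n : N) : IsCofinal {f : FGEquivOver h r | n ∈ f.1.1.cod} := fun f => by
    obtain ⟨f', hf', le⟩ := H' f.symm n
    exact ⟨f'.symm, hf', PartialEquiv.monotone_symm le⟩
  let D : M ⊕ N → Order.Cofinal (FGEquivOver h r) :=
    Sum.elim (fun m => ⟨{f | m ∈ f.1.1.dom}, fun f => H f m⟩) fun n => ⟨_, cofinal_cod n⟩
  let S : ℕ →o FGEquivOver h r :=
    ⟨Order.sequenceOfCofinals g D, Order.sequenceOfCofinals.monotone _ _⟩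
  let S' : ℕ →o M ≃ₚ[L] N := ⟨fun n => (S n).1.1, fun _ _ hmn => S.monotone hmn⟩
  have dom_top : (DirectLimit.partialEquivLimit S').dom = ⊤ := top_le_iff.1 fun m _ =>
    PartialEquiv.dom_le_dom (DirectLimit.le_partialEquivLimit S' _)
      (Order.sequenceOfCofinals.encode_mem g D (Sum.inl m))
  have cod_top : (DirectLimit.partialEquivLimit S').cod = ⊤ := top_le_iff.1 fun n _ =>
    PartialEquiv.cod_le_cod (DirectLimit.le_partialEquivLimit S' _)
      (Order.sequenceOfCofinals.encode_mem g D (Sum.inr n))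
  have key (x : M) : PartialEquiv.toEquivOfEqTop dom_top cod_top x =
      (DirectLimit.partialEquivLimit S').toEquiv ⟨x, dom_top.symm ▸ mem_top x⟩ := by
    rw [← PartialEquiv.toEmbeddingOfEqTop_apply dom_top,
      ← PartialEquiv.toEquivOfEqTop_toEmbedding dom_top cod_top]
    rfl
  refine ⟨PartialEquiv.toEquivOfEqTop dom_top cod_top, fun x => ?_, fun x => ?_⟩
  · rw [key]
    exact FGEquivOver.partialEquivLimit_comm S _
  · rw [key]
    -- The chain starts at `g`, so its limit extends `g`.
    exact congrArg Subtype.val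
      (PartialEquiv.toEquiv_inclusion_apply (DirectLimit.le_partialEquivLimit S' 0) x)

end BackAndForth

/-! ### Richness, universality and homogeneity -/

section UniversalHomogeneous

variable {L : Language.{u, v}} {U B : Type w} [L.Structure U] [L.Structure B]

theorem IsRich.isExtensionPairOver {r : U →[L] B} (hr : IsRich r) {M : Type w} [L.Structure M]
    (hM : L.age M ⊆ L.age U) (h : M →[L] B) : IsExtensionPairOver h r := by
  rintro ⟨⟨f, f_fg⟩, hf⟩ m
  let D := closure L {m} ⊔ f.dom
  have hD : D.FG := (fg_closure_singleton m).sup f_fg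
  obtain ⟨j, hj, hj'⟩ := hr (hM (age.fg_substructure f_fg)) (hM (age.fg_substructure hD))
    f.toEmbedding (Substructure.inclusion le_sup_right) (h.comp D.subtype.toHom)
    fun a => (hf a).symm
  refine ⟨⟨⟨⟨D, j.toHom.range, j.equivRange⟩, hD⟩, hj'⟩,
    le_sup_left (a := closure L {m}) (subset_closure rfl), le_sup_right, ?_⟩
  exact Embedding.ext hj

theorem IsRich.isUniversalHom [Countable U] {r : U →[L] B} (hr : IsRich r) :
    IsUniversalHom (L.age U) r := by
  rintro A ⟨hA, hAU⟩ h
  -- The starting equivalence lives on the substructure generated by the constants, where any two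
  -- homomorphisms agree.
  obtain ⟨-, ⟨i⟩⟩ := hAU (age.fg_substructure (fg_bot (L := L) (M := A)))
  have hi (x : (⊥ : L.Substructure A)) : r (i x) = h x := by
    have : closure L (∅ : Set (⊥ : L.Substructure A)) = ⊤ := by
      rw [Substructure.closure_empty]
      refine top_le_iff.1 fun x _ => ?_
      have hx : (x : A) ∈ (⊥ : L.Substructure (⊥ : L.Substructure A)).map
          (⊥ : L.Substructure A).subtype.toHom := bot_le (α := L.Substructure A) x.2
      obtain ⟨y, hy, e⟩ := hx
      exact Subtype.ext e ▸ hy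
    exact DFunLike.congr_fun (Hom.eq_of_eqOn_dense this (f := r.comp i.toHom)
      (g := h.comp (⊥ : L.Substructure A).subtype.toHom) fun x hx => hx.elim) x
  obtain ⟨f, hf⟩ := (hr.isExtensionPairOver hAU h).exists_embedding
    ⟨⟨⟨⊥, i.toHom.range, i.equivRange⟩, fg_bot⟩, hi⟩
  exact ⟨f, Hom.ext fun x => (hf x).symm⟩

theorem IsRich.isHomogeneousHom [Countable U] {r : U →[L] B} (hr : IsRich r) :
    IsHomogeneousHom r := by
  intro A hA ι hι
  have H := hr.isExtensionPairOver subset_rfl r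
  obtain ⟨α, hα, hα'⟩ := H.exists_equiv H
    ⟨⟨⟨A, ι.toHom.range, ι.equivRange⟩, hA⟩, fun x => (DFunLike.congr_fun hι x).symm⟩
  exact ⟨α, Hom.ext hα, Embedding.ext hα'⟩

theorem IsRich.isUniversalHomogeneousRetraction [Countable U] {r : U →[L] B} (hr : IsRich r)
    (hB : (Bundled.of B : Bundled.{w} L.Structure) ∈ younger (L.age U)) :
    IsUniversalHomogeneousRetraction r where
  mem_younger := hB
  isRetraction := by
    obtain ⟨ι, hι⟩ := hr.isUniversalHom _ hB (Hom.id L B)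
    exact ⟨ι.toHom, hι.symm⟩
  isUniversalHom := hr.isUniversalHom
  isHomogeneousHom := hr.isHomogeneousHom

/-- Universality turns `f₂` into an embedding of `A` in `U`; this extends to `B₁`, and `r` brings
the extension back to `B`. -/
theorem IsUniversalHom.homoAmalgamation [Countable U] (hom : L.IsUltrahomogeneous U) {r : U →[L] B}
    (hr : IsUniversalHom (L.age U) r) (s : U ↪[L] B) (t : B ↪[L] U) :
    HomoAmalgamation (L.age U) := by
  rintro A B₁ B₂ hA hB₁ hB₂ f₁ f₂
  have young {M : Bundled.{w} L.Structure} (hM : M ∈ L.age U) : M ∈ younger (L.age U) :=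
    ⟨hM.2.some.injective.countable, age.hereditary U M hM⟩
  obtain ⟨i₂⟩ := hB₂.2
  obtain ⟨i, hi⟩ := hr A (young hA) ((s.comp i₂).toHom.comp f₂)
  have := hB₁.2
  obtain ⟨j, hj⟩ := hom.extend_embedding hA.1 i f₁
  let g₁ : B₁ →[L] B := r.comp j.toHom
  let g₂ : B₂ ↪[L] B := s.comp i₂
  let C := g₁.range ⊔ g₂.toHom.range
  have hC : C.FG := (FG.range hB₁.1 g₁).sup (FG.range hB₂.1 g₂.toHom)
  refine ⟨Bundled.of C, ⟨(fg_iff_structure_fg _).1 hC, ⟨t.comp C.subtype⟩⟩,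
    g₁.codRestrict C fun b => le_sup_left (a := g₁.range) (g₁.mem_range_self b),
    g₂.codRestrict C fun b => le_sup_right (a := g₁.range) (g₂.toHom.mem_range_self b),
    Hom.ext fun a => Subtype.ext ?_⟩
  exact (congrArg r (DFunLike.congr_fun hj a)).symm.trans (DFunLike.congr_fun hi a).symm

theorem IsUniversalHom.amalgamatedExtension [Countable U] {r : U →[L] B}
    (hr : IsUniversalHom (L.age U) r) (hr' : IsHomogeneousHom r) (s : U ↪[L] B) (t : B ↪[L] U) :
    AmalgamatedExtension (L.age U) := by
  rintro A B₁ B₂ T hA hB₁ hB₂ hT f₁ f₂ h₁ h₂ hf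
  have young {M : Bundled.{w} L.Structure} (hM : M ∈ L.age U) : M ∈ younger (L.age U) :=
    ⟨hM.2.some.injective.countable, age.hereditary U M hM⟩
  obtain ⟨iT⟩ := hT.2
  let k : T ↪[L] B := s.comp iT
  obtain ⟨i₁, e₁⟩ := hr B₁ (young hB₁) (k.toHom.comp h₁)
  obtain ⟨i₂, e₂⟩ := hr B₂ (young hB₂) (k.toHom.comp h₂)
  let j₁ := i₁.comp f₁
  let j₂ := i₂.comp f₂
  have hj (a) : r (j₁ a) = r (j₂ a) :=
    ((DFunLike.congr_fun e₁ (f₁ a)).symm.trans (congrArg k (DFunLike.congr_fun hf a))).trans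
      (DFunLike.congr_fun e₂ (f₂ a))
  -- The two copies of `A` agree under `r`, so an automorphism over `r` carries one to the other.
  obtain ⟨α, hα, hα'⟩ := hr' j₁.toHom.range (FG.range hA.1 j₁.toHom)
    (j₂.comp j₁.equivRange.symm.toEmbedding) (Hom.ext fun x => by
      obtain ⟨a, rfl⟩ := j₁.equivRange.surjective x
      refine (hj a).trans (congrArg (fun c => r (j₂ c)) ?_)
      exact (j₁.equivRange.symm_apply_apply a).symm)
  have hα₁ (a) : α (j₁ a) = j₂ a := (DFunLike.congr_fun hα' (j₁.equivRange a)).trans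
    (congrArg j₂ (j₁.equivRange.symm_apply_apply a))
  let g₁ : B₁ ↪[L] U := α.toEmbedding.comp i₁
  let C := g₁.toHom.range ⊔ i₂.toHom.range
  have hC : C.FG := (FG.range hB₁.1 g₁.toHom).sup (FG.range hB₂.1 i₂.toHom)
  let h : C →[L] B := r.comp C.subtype.toHom
  let T' := h.range ⊔ k.toHom.range
  have hT' : T'.FG := (FG.range ((fg_iff_structure_fg _).1 hC) h).sup (FG.range hT.1 k.toHom)
  refine ⟨Bundled.of C, Bundled.of T', age.fg_substructure hC,
    ⟨(fg_iff_structure_fg _).1 hT', ⟨t.comp T'.subtype⟩⟩,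
    g₁.codRestrict C fun b => le_sup_left (a := g₁.toHom.range) (g₁.toHom.mem_range_self b),
    i₂.codRestrict C fun b => le_sup_right (a := g₁.toHom.range) (i₂.toHom.mem_range_self b),
    h.codRestrict T' fun b => le_sup_left (a := h.range) (h.mem_range_self b),
    k.codRestrict T' fun b => le_sup_right (a := h.range) (k.toHom.mem_range_self b),
    Embedding.ext fun a => Subtype.ext (hα₁ a), Hom.ext fun b => Subtype.ext ?_,
    Hom.ext fun b => Subtype.ext (DFunLike.congr_fun e₂ b).symm⟩
  exact (DFunLike.congr_fun hα (i₁ b)).trans (DFunLike.congr_fun e₁ b).symm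

end UniversalHomogeneous

end FirstOrder.Language

theorem mainTheorem7 {L : FirstOrder.Language.{u, v}}
    [Countable (Σ l, L.Functions l)]
    (K : Set (Bundled.{w} L.Structure)) (hK : FirstOrder.Language.IsFraisse K)
    (U : Type w) [L.Structure U] [Countable U]
    (hU : FirstOrder.Language.IsFraisseLimit K U) :
    (FirstOrder.Language.HomoAmalgamation K ∧ FirstOrder.Language.AmalgamatedExtension K) ↔
      ∀ B : L.Substructure U, FirstOrder.Language.IsRetract B →
        ∃ r : U →[L] B, FirstOrder.Language.IsUniversalHomogeneousRetraction r := by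
  obtain ⟨hom, rfl⟩ := hU
  constructor
  · rintro ⟨hap, aep⟩ B ⟨e, he, rfl⟩
    have hρ (b : e.range) : e.codRestrict e.range e.mem_range_self (e.range.subtype b) = b := by
      obtain ⟨_, x, rfl⟩ := b
      exact Subtype.ext (DFunLike.congr_fun he x)
    obtain ⟨r, hr⟩ := FirstOrder.Language.exists_isRich hom e.range.subtype _ hρ hap aep
    exact ⟨r, hr.isUniversalHomogeneousRetraction
      ⟨inferInstanceAs (Countable e.range), e.range.subtype.age_subset_age⟩⟩
  · intro H
    -- Only the trivial retract, the image of the identity, is needed.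
    obtain ⟨r, hr⟩ := H ⊤ ⟨FirstOrder.Language.Hom.id L U, rfl,
      top_le_iff.1 fun x _ => ⟨x, rfl⟩⟩
    let s := (FirstOrder.Language.Substructure.topEquiv (L := L) (M := U)).symm.toEmbedding
    let t := (FirstOrder.Language.Substructure.topEquiv (L := L) (M := U)).toEmbedding
    exact ⟨hr.isUniversalHom.homoAmalgamation hom s t,
      hr.isUniversalHom.amalgamatedExtension hr.isHomogeneousHom s t⟩
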